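/- Let $(X,d)$ be a compact metric space with Borel $\sigma$-algebra $\mathscr B(X)$, and let $T$ be a correspondence on $X$, i.e. an upper semicontinuous map from $X$ to the nonempty closed subsets of $X$. For $n\ge 1$ let $\mathcal O_{n}(T)=\{(x_1,\dots,x_n)\in X^n: x_{i+1}\in T(x_i),\ 1\le i<n\}$ with the metric $d_n(x,y)=\max_i d(x_i,y_i)$. For $\phi\in C(\mathcal O_2(T))$ (real-valued continuous functions) put $S_n\phi(x_1,\dots,x_{n+1})=\sum_{i=1}^n\phi(x_i,x_{i+1})$ and let $$P(T,\phi)=\lim_{\epsilon\to0^+}\limsup_{n\to\infty}\frac1n\log\sup_{E}\sum_{x\in E}e^{S_n\phi(x)}\in[-\infty,+\infty],$$ where $E$ ranges over the subsets of $\mathcal O_{n+1}(T)$ any two distinct points of which have distance at least $\epsilon$. The topological entropy of $T$ is $P(T,0)$. A transition probability kernel $\mathcal Q$ on $X$ is supported by $T$ if $\mathcal Q_x(T(x))=1$ for every $x\in X$; a Borel probability measure $\mu$ is $\mathcal Q$-invariant if $\mu\mathcal Q=\mu$. Let $\mathcal Q^{[0]}_x=\delta_x$ and let $\mathcal Q^{[n]}_x(A)=\int\mathcal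 Q\bigl(x_n,\{y:(x_1,\dots,x_n,y)\in A\}\bigr)\,d\mathcal Q^{[n-1]}_x(x_1,\dots,x_n)$ be the induced kernels from $X$ to $X^{n+1}$. For $\mathcal Q$-invariant $\mu$ let $$h_\mu(\mathcal Q)=\sup_{\mathcal A}\lim_{n\to\infty}\frac1n H_{\mu\mathcal Q^{[n-1]}}(\mathcal A^n),$$ where $\mathcal A$ ranges over the finite measurable partitions of $X$, $\mathcal A^n$ is the product partition of $X^n$ and $H_m(\mathcal B)=-\sum_{B\in\mathcal B}m(B)\log m(B)$. For $\mathcal Q$ supported by $T$ and any Borel probability measure $\mu$ on $X$ let $$\mathfrak h_\mu(\mathcal Q)=\inf\Bigl\{\int_X\int_{T(x)}\psi(x,y)\,d\mathcal Q_x(y)\,d\mu(x):\ \psi\in C(\mathcal O_2(T)),\ P(T,-\psi)\le0\Bigr\}.$$ Consider pairs $(\mathcal Q,\mu)$ of a transition probability kernel $\mathcal Q$ on $X$ supported by $T$ and a Borel probability measure $\mu$ on $X$, and let $\phi\in C(\mathcal O_2(T))$. Such a pair is * a type I equilibrium state for $\phi$ if $\mu$ is $\mathcal Q$-invariant and $P(T,\phi)=h_\mu(\mathcal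 Q)+\int_X\int_{T(x)}\phi(x,y)\,d\mathcal Q_x(y)\,d\mu(x)$; * a type II equilibrium state for $\phi$ if $P(T,\phi)=\mathfrak h_\mu(\mathcal Q)+\int_X\int_{T(x)}\phi(x,y)\,d\mathcal Q_x(y)\,d\mu(x)$; * a tangent functional to $P(T,\cdot)$ at $\phi$ if $P(T,\phi+\psi)-P(T,\phi)\ge\int_{\mathcal O_2(T)}\psi\,d(\mu\mathcal Q^{[1]})$ for all $\psi\in C(\mathcal O_2(T))$. Denote the sets of these pairs by $e^1_\phi(X,T)$, $e^2_\phi(X,T)$ and $t_\phi(X,T)$. **Theorem.** Suppose that $T$ has finite topological entropy, $P(T,0)<+\infty$. Then for every $\phi\in C(\mathcal O_2(T))$: 1. $e^1_\phi(X,T)\subset t_\phi(X,T)$; 2. $e^2_\phi(X,T)=t_\phi(X,T)$. -/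

import Mathlib

open Filter Topology MeasureTheory ProbabilityTheory

/-- A correspondence on `X`: an upper semicontinuous map from `X` to the nonempty closed subsets
of `X`. -/
structure Correspondence (X : Type*) [TopologicalSpace X] where
  toFun : X → Set X
  nonempty' : ∀ x, (toFun x).Nonempty
  isClosed' : ∀ x, IsClosed (toFun x)
  upperHemicontinuous' : UpperHemicontinuous toFun

namespace Correspondence

instance {X : Type*} [TopologicalSpace X] : CoeFun (Correspondence X) (fun _ => X → Set X) :=
  ⟨Correspondence.toFun⟩

/-- The set `𝒪_n(T)` of orbits `(x_1, …, x_n)` (indexed from `0`), with `x_{i+1} ∈ T(x_i)`. As a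
subset of `Fin n → X` it carries the metric `max_i d(x_i, y_i)`. -/
def orbits {X : Type*} [TopologicalSpace X] (T : Correspondence X) (n : ℕ) : Set (Fin n → X) :=
  {x | ∀ (i : ℕ) (h : i + 1 < n), x ⟨i + 1, h⟩ ∈ T (x ⟨i, Nat.lt_of_succ_lt h⟩)}

/-- The element `(x, y)` of `𝒪_2(T)`, for `y ∈ T(x)`. -/
def pair {X : Type*} [TopologicalSpace X] (T : Correspondence X) (x : X) (y : T x) :
    T.orbits 2 :=
  ⟨![x, (y : X)], by
    intro i h
    obtain rfl : i = 0 := by omega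
    exact y.2⟩

theorem isClosed_orbits {X : Type*} [MetricSpace X] (T : Correspondence X) (n : ℕ) :
    IsClosed (T.orbits n) := by
  refine IsSeqClosed.isClosed ?_
  intro u a hu ha i h
  have h0 := (continuous_apply (⟨i, Nat.lt_of_succ_lt h⟩ : Fin n)).continuousAt.tendsto.comp ha
  have h1 := (continuous_apply (⟨i + 1, h⟩ : Fin n)).continuousAt.tendsto.comp ha
  exact UpperHemicontinuousAt.mem_of_tendsto (T.upperHemicontinuous' _) (T.isClosed' _) h0
    (Eventually.of_forall fun k => hu k i h).frequently h1

/-- The Birkhoff sum `S_n φ (x_1, …, x_{n+1}) = ∑_{i=1}^n φ(x_i, x_{i+1})` on `𝒪_{n+1}(T)`. -/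
noncomputable def birkhoffSum {X : Type*} [TopologicalSpace X] (T : Correspondence X)
    (φ : C(T.orbits 2, ℝ)) (n : ℕ) (x : T.orbits (n + 1)) : ℝ :=
  ∑ i : Fin n, φ (T.pair (x.1 i.castSucc) ⟨x.1 i.succ, x.2 i.1 (Nat.succ_lt_succ i.2)⟩)

/-- `s_n(T, φ, ε)`: the supremum of `∑_{x ∈ E} exp (S_n φ x)` over the `ε`-separated subsets `E` of
`𝒪_{n+1}(T)`, where separated means that distinct points have distance at least `ε`. -/
noncomputable def sepSum {X : Type*} [MetricSpace X] (T : Correspondence X)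
    (φ : C(T.orbits 2, ℝ)) (n : ℕ) (ε : ℝ) : ENNReal :=
  ⨆ (E : Set (T.orbits (n + 1))) (_ : E.Pairwise fun x y => ε ≤ dist x y),
    ∑' x : E, ENNReal.ofReal (Real.exp (T.birkhoffSum φ n x))

/-- `limsup_n (1/n) log s_n(T, φ, ε)`. -/
noncomputable def pressureAt {X : Type*} [MetricSpace X] (T : Correspondence X)
    (φ : C(T.orbits 2, ℝ)) (ε : ℝ) : EReal :=
  limsup (fun n : ℕ => ENNReal.log (T.sepSum φ n ε) / (n : EReal)) atTop

/-- The topological pressure `P(T, φ) = lim_{ε → 0+} limsup_n (1/n) log s_n(T, φ, ε)`, with values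
in the extended reals. The quantity under the limit is antitone in `ε`, so the limit is the
supremum over `ε > 0`; see `tendsto_pressureAt`. -/
noncomputable def pressure {X : Type*} [MetricSpace X] (T : Correspondence X)
    (φ : C(T.orbits 2, ℝ)) : EReal :=
  ⨆ (ε : ℝ) (_ : 0 < ε), T.pressureAt φ ε

theorem pressureAt_antitone {X : Type*} [MetricSpace X] (T : Correspondence X)
    (φ : C(T.orbits 2, ℝ)) : Antitone (T.pressureAt φ) := by
  intro a b hab
  refine limsup_le_limsup (Eventually.of_forall fun n => ?_)
  refine EReal.div_le_div_right_of_nonneg (Nat.cast_nonneg' n) (ENNReal.log_monotone ?_)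
  refine iSup_mono fun E => iSup_le fun hE => ?_
  exact le_iSup_of_le (fun x hx y hy hxy => hab.trans (hE hx hy hxy)) le_rfl

theorem tendsto_pressureAt {X : Type*} [MetricSpace X] (T : Correspondence X)
    (φ : C(T.orbits 2, ℝ)) : Tendsto (T.pressureAt φ) (𝓝[>] 0) (𝓝 (T.pressure φ)) := by
  have h := (T.pressureAt_antitone φ).tendsto_nhdsGT 0
  rwa [sSup_image] at h

/-- The topological entropy `P(T, 0)`. -/
noncomputable def topEntropy {X : Type*} [MetricSpace X] (T : Correspondence X) : EReal :=
  T.pressure 0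

/-- The kernel `Q` is supported by `T`: `Q_x(T(x)) = 1` for every `x`. -/
def Supports {X : Type*} [TopologicalSpace X] [MeasurableSpace X] (T : Correspondence X)
    (Q : Kernel X X) : Prop :=
  ∀ x, Q x (T x) = 1

end Correspondence

/-- The kernel `Q^{[n]}` from `X` to `X^{n+1}`: `Q^{[0]}_x` is the Dirac measure at `x`, and
`Q^{[n+1]}_x` is the law obtained from `Q^{[n]}_x` by appending a point chosen according to
`Q_{x_{n+1}}`; see `kernelPath_succ_apply`. -/
noncomputable def kernelPath {X : Type*} [MeasurableSpace X] (Q : Kernel X X) :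
    (n : ℕ) → Kernel X (Fin (n + 1) → X)
  | 0 => Kernel.deterministic (fun x _ => x) (measurable_pi_lambda _ fun _ => measurable_id)
  | n + 1 =>
    ((kernelPath Q n).compProd
      (Q.comap (fun p : X × (Fin (n + 1) → X) => p.2 (Fin.last n))
        ((measurable_pi_apply _).comp measurable_snd))).map
      (fun p : (Fin (n + 1) → X) × X => (Fin.snoc p.1 p.2 : Fin (n + 2) → X))

theorem measurable_snoc {X : Type*} [MeasurableSpace X] (n : ℕ) :
    Measurable (fun p : (Fin n → X) × X => (Fin.snoc p.1 p.2 : Fin (n + 1) → X)) := by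
  refine measurable_pi_lambda _ fun i => ?_
  refine Fin.lastCases ?_ (fun j => ?_) i
  · simpa using measurable_snd
  · simpa [Function.comp_def] using
      (measurable_pi_apply j).comp (measurable_fst (α := Fin n → X) (β := X))

instance isMarkovKernel_kernelPath {X : Type*} [MeasurableSpace X] (Q : Kernel X X)
    [IsMarkovKernel Q] : (n : ℕ) → IsMarkovKernel (kernelPath Q n)
  | 0 => by unfold kernelPath; infer_instance
  | n + 1 => by
    have := isMarkovKernel_kernelPath Q n
    unfold kernelPath
    exact Kernel.IsMarkovKernel.map _ (measurable_snoc _)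

/-- `Q^{[n+1]}(x, A) = ∫ Q(x_{n+1}, {y | (x_1, …, x_{n+1}, y) ∈ A}) dQ^{[n]}_x(x_1, …, x_{n+1})`. -/
theorem kernelPath_succ_apply {X : Type*} [MeasurableSpace X] (Q : Kernel X X)
    [IsMarkovKernel Q] (n : ℕ) (x : X) {A : Set (Fin (n + 2) → X)} (hA : MeasurableSet A) :
    kernelPath Q (n + 1) x A =
      ∫⁻ p, Q (p (Fin.last n)) {y | (Fin.snoc p y : Fin (n + 2) → X) ∈ A} ∂(kernelPath Q n x) := by
  rw [kernelPath, Kernel.map_apply' _ (measurable_snoc _) _ hA,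
    Kernel.compProd_apply (measurable_snoc _ hA)]
  rfl

/-- A finite measurable partition `{A_1, …, A_k}` of `X`. -/
structure FinMeasurablePartition (X : Type*) [MeasurableSpace X] where
  card : ℕ
  cell : Fin card → Set X
  measurableSet_cell : ∀ i, MeasurableSet (cell i)
  disjoint_cell : Pairwise fun i j => Disjoint (cell i) (cell j)
  iUnion_cell : ⋃ i, cell i = Set.univ

/-- The entropy `H_m(𝒜^n) = -∑ m(A_{a_1} × ⋯ × A_{a_n}) log m(A_{a_1} × ⋯ × A_{a_n})` of the product
partition `𝒜^n` of `X^n` with respect to a probability measure `m` on `X^n`. -/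
noncomputable def FinMeasurablePartition.powEntropy {X : Type*} [MeasurableSpace X]
    (𝒜 : FinMeasurablePartition X) (n : ℕ) (m : Measure (Fin n → X)) : ℝ :=
  ∑ a : Fin n → Fin 𝒜.card, Real.negMulLog (m.real (Set.univ.pi fun i => 𝒜.cell (a i)))

/-- `h_μ(Q, 𝒜) = lim_n (1/n) H_{μ Q^{[n-1]}}(𝒜^n)`, written with `n + 1` for `n`. For a
`Q`-invariant probability measure `μ` the entropies are subadditive in `n`, so the limit exists
and is this upper limit. -/
noncomputable def kernelEntropyOf {X : Type*} [MeasurableSpace X] (Q : Kernel X X) (μ : Measure X)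
    (𝒜 : FinMeasurablePartition X) : EReal :=
  limsup (fun n : ℕ =>
    ((𝒜.powEntropy (n + 1) (μ.bind (kernelPath Q n)) / ((n : ℝ) + 1) : ℝ) : EReal)) atTop

/-- The measure-theoretic entropy `h_μ(Q) = sup_𝒜 h_μ(Q, 𝒜)`. -/
noncomputable def kernelEntropy {X : Type*} [MeasurableSpace X] (Q : Kernel X X)
    (μ : Measure X) : EReal :=
  ⨆ 𝒜 : FinMeasurablePartition X, kernelEntropyOf Q μ 𝒜

namespace Correspondence

/-- `∫_X ∫_{T(x)} φ(x, y) dQ_x(y) dμ(x)`. -/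
noncomputable def doubleIntegral {X : Type*} [TopologicalSpace X] [MeasurableSpace X]
    (T : Correspondence X) (φ : C(T.orbits 2, ℝ)) (Q : Kernel X X) (μ : Measure X) : ℝ :=
  ∫ x, ∫ y : T x, φ (T.pair x y) ∂((Q x).comap Subtype.val) ∂μ

/-- `∫_{𝒪_2(T)} φ d(μ Q^{[1]})`. -/
noncomputable def orbitIntegral {X : Type*} [TopologicalSpace X] [MeasurableSpace X]
    (T : Correspondence X) (φ : C(T.orbits 2, ℝ)) (Q : Kernel X X) (μ : Measure X) : ℝ :=
  ∫ p : T.orbits 2, φ p ∂((μ.bind (kernelPath Q 1)).comap Subtype.val)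

/-- The abstract entropy `𝔥_μ(Q)`: the infimum of `∫_X ∫_{T(x)} φ(x, y) dQ_x(y) dμ(x)` over the
continuous `φ` on `𝒪_2(T)` with `P(T, -φ) ≤ 0`. -/
noncomputable def abstractEntropy {X : Type*} [MetricSpace X] [MeasurableSpace X]
    (T : Correspondence X) (Q : Kernel X X) (μ : Measure X) : EReal :=
  ⨅ (φ : C(T.orbits 2, ℝ)) (_ : T.pressure (-φ) ≤ 0), (T.doubleIntegral φ Q μ : EReal)

/-- The pairs `(Q, μ)` of a transition probability kernel `Q` on `X` supported by `T` and a Borel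
probability measure `μ` on `X`. -/
def admissiblePairs {X : Type*} [TopologicalSpace X] [MeasurableSpace X] (T : Correspondence X) :
    Set (Kernel X X × Measure X) :=
  {p | IsMarkovKernel p.1 ∧ T.Supports p.1 ∧ IsProbabilityMeasure p.2}

/-- The set `e¹_φ(X, T)` of type I equilibrium states. -/
def typeIEquilibriumStates {X : Type*} [MetricSpace X] [MeasurableSpace X]
    (T : Correspondence X) (φ : C(T.orbits 2, ℝ)) : Set (Kernel X X × Measure X) :=
  {p | p ∈ T.admissiblePairs ∧ p.1.Invariant p.2 ∧
    T.pressure φ = kernelEntropy p.1 p.2 + (T.doubleIntegral φ p.1 p.2 : EReal)}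

/-- The set `e²_φ(X, T)` of type II equilibrium states; `μ` is not assumed `Q`-invariant. -/
def typeIIEquilibriumStates {X : Type*} [MetricSpace X] [MeasurableSpace X]
    (T : Correspondence X) (φ : C(T.orbits 2, ℝ)) : Set (Kernel X X × Measure X) :=
  {p | p ∈ T.admissiblePairs ∧
    T.pressure φ = T.abstractEntropy p.1 p.2 + (T.doubleIntegral φ p.1 p.2 : EReal)}

/-- The set `t_φ(X, T)` of tangent functionals to `P(T, ·)` at `φ`. It is used only when
`T` has finite topological entropy, where every `P(T, ψ)` occurring here is finite. -/
def tangentFunctionals {X : Type*} [MetricSpace X] [MeasurableSpace X]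
    (T : Correspondence X) (φ : C(T.orbits 2, ℝ)) : Set (Kernel X X × Measure X) :=
  {p | p ∈ T.admissiblePairs ∧ ∀ ψ : C(T.orbits 2, ℝ),
    T.pressure (φ + ψ) - T.pressure φ ≥ (T.orbitIntegral ψ p.1 p.2 : EReal)}

end Correspondence

/-!
The tangent functionals at `φ` and the type II equilibrium states are both the admissible pairs
`(Q, μ)` with `P(T, φ) + ∫ ψ ≤ P(T, φ + ψ)` for all `ψ`: adding a constant `c` to `φ` adds at most
`c` to the pressure, which makes `𝔥_μ(Q)` the infimum of `P(T, ψ) - ∫ ψ` over `ψ`.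

For an invariant `μ` the variational inequality `h_μ(Q) + ∫ ψ ≤ P(T, ψ)` therefore gives
`h_μ(Q) ≤ 𝔥_μ(Q)`, so type I equilibrium states are of type II. To prove it, choose an orbit `x` in
a finite net of `𝒪_{n+1}(T)` with probability proportional to `exp (S_n ψ x)` and send the cell
labels of `x` through a memoryless channel that corrupts each letter with probability `δ`. By
Gibbs' inequality the entropy of the law of the itineraries is at most its cross entropy relative
to the law of the received word. A `μ`-typical orbit is shadowed by a net orbit with nearly the same
Birkhoff sum, and the noise makes the few labels that differ, near the boundaries of the cells, cost
only `log (k / δ)` each, where `k` is the number of cells.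
-/

namespace Correspondence

section Orbits

variable {X : Type*} [TopologicalSpace X] (T : Correspondence X)

theorem mem_orbits_succ_iff {n : ℕ} {y : Fin (n + 1) → X} :
    y ∈ T.orbits (n + 1) ↔ ∀ i : Fin n, y i.succ ∈ T (y i.castSucc) :=
  ⟨fun h i => h i.1 (Nat.succ_lt_succ i.2), fun h i hi => h ⟨i, Nat.lt_of_succ_lt_succ hi⟩⟩

theorem mem_orbits_two {y : Fin 2 → X} : y ∈ T.orbits 2 ↔ y 1 ∈ T (y 0) := by
  simp [mem_orbits_succ_iff]

instance nonempty_orbits [Nonempty X] (n : ℕ) : Nonempty (T.orbits n) := by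
  choose f hf using T.nonempty'
  obtain ⟨x₀⟩ := ‹Nonempty X›
  refine ⟨fun i => f^[i] x₀, fun i h => ?_⟩
  simp only [Function.iterate_succ_apply']
  exact hf _

theorem birkhoffSum_le_add {φ ψ : C(T.orbits 2, ℝ)} {c : ℝ} (h : ∀ p, φ p ≤ ψ p + c) (n : ℕ)
    (x : T.orbits (n + 1)) : T.birkhoffSum φ n x ≤ T.birkhoffSum ψ n x + n * c := by
  refine (Finset.sum_le_sum fun i _ => h _).trans_eq ?_
  simp [birkhoffSum, Finset.sum_add_distrib]

end Orbits

variable {X : Type*} [MetricSpace X] (T : Correspondence X)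

theorem isClosed_graph : IsClosed {p : X × X | p.2 ∈ T p.1} := by
  have h : Continuous fun p : X × X => ![p.1, p.2] := by fun_prop
  simpa [Set.preimage, mem_orbits_two] using (T.isClosed_orbits 2).preimage h

instance compactSpace_orbits [CompactSpace X] (n : ℕ) : CompactSpace (T.orbits n) :=
  isCompact_iff_compactSpace.1 (T.isClosed_orbits n).isCompact

section Pressure

theorem sepSum_le_exp_mul {φ ψ : C(T.orbits 2, ℝ)} {c : ℝ} (h : ∀ p, φ p ≤ ψ p + c) (n : ℕ)
    (ε : ℝ) : T.sepSum φ n ε ≤ ENNReal.ofReal (Real.exp (n * c)) * T.sepSum ψ n ε := by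
  refine iSup₂_le fun E hE => ?_
  calc ∑' x : E, ENNReal.ofReal (Real.exp (T.birkhoffSum φ n x))
      ≤ ∑' x : E, ENNReal.ofReal (Real.exp (n * c)) *
          ENNReal.ofReal (Real.exp (T.birkhoffSum ψ n x)) := by
        refine ENNReal.tsum_le_tsum fun x => ?_
        rw [← ENNReal.ofReal_mul (Real.exp_nonneg _), ← Real.exp_add]
        gcongr
        linarith [T.birkhoffSum_le_add h n x]
    _ = ENNReal.ofReal (Real.exp (n * c)) *
          ∑' x : E, ENNReal.ofReal (Real.exp (T.birkhoffSum ψ n x)) := ENNReal.tsum_mul_left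
    _ ≤ ENNReal.ofReal (Real.exp (n * c)) * T.sepSum ψ n ε := by
        gcongr
        exact le_iSup₂_of_le E hE le_rfl

theorem log_sepSum_div_le_add {φ ψ : C(T.orbits 2, ℝ)} {c : ℝ} (h : ∀ p, φ p ≤ ψ p + c) {n : ℕ}
    (hn : 0 < n) (ε : ℝ) :
    ENNReal.log (T.sepSum φ n ε) / (n : EReal) ≤
      ENNReal.log (T.sepSum ψ n ε) / (n : EReal) + c := by
  have hlog := ENNReal.log_monotone (T.sepSum_le_exp_mul h n ε)
  rw [ENNReal.log_mul_add, ENNReal.log_ofReal_of_pos (Real.exp_pos _), Real.log_exp] at hlog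
  have hc : ((n * c : ℝ) : EReal) / (n : EReal) = c := by
    rw [← EReal.coe_coe_eq_natCast, ← EReal.coe_div, mul_div_cancel_left₀ _ (by positivity)]
  calc ENNReal.log (T.sepSum φ n ε) / (n : EReal)
      ≤ (((n * c : ℝ) : EReal) + ENNReal.log (T.sepSum ψ n ε)) / (n : EReal) :=
        EReal.div_le_div_right_of_nonneg (Nat.cast_nonneg' n) hlog
    _ = ENNReal.log (T.sepSum ψ n ε) / (n : EReal) + c := by
        rw [EReal.add_div_of_nonneg_right (Nat.cast_nonneg' n), hc, add_comm]

theorem pressureAt_le_add {φ ψ : C(T.orbits 2, ℝ)} {c : ℝ} (h : ∀ p, φ p ≤ ψ p + c) (ε : ℝ) :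
    T.pressureAt φ ε ≤ T.pressureAt ψ ε + c := by
  have hc : limsup (fun _ : ℕ => (c : EReal)) atTop = c := limsup_const _
  calc T.pressureAt φ ε
      ≤ limsup ((fun n : ℕ => ENNReal.log (T.sepSum ψ n ε) / (n : EReal)) +
          fun _ => (c : EReal)) atTop :=
        limsup_le_limsup <| (eventually_gt_atTop 0).mono fun _ hn =>
          T.log_sepSum_div_le_add h hn ε
    _ ≤ T.pressureAt ψ ε + limsup (fun _ : ℕ => (c : EReal)) atTop :=
        EReal.limsup_add_le (.inr (by simp)) (.inr (by simp))
    _ = T.pressureAt ψ ε + c := by rw [hc]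

theorem pressure_le_add {φ ψ : C(T.orbits 2, ℝ)} {c : ℝ} (h : ∀ p, φ p ≤ ψ p + c) :
    T.pressure φ ≤ T.pressure ψ + c := by
  refine iSup₂_le fun ε hε => (T.pressureAt_le_add h ε).trans ?_
  gcongr
  exact le_iSup₂_of_le ε hε le_rfl

theorem pressure_zero_nonneg [Nonempty X] : 0 ≤ T.pressure 0 := by
  refine le_iSup₂_of_le 1 one_pos (le_limsup_of_frequently_le (.of_forall fun n => ?_))
  refine EReal.div_nonneg (ENNReal.log_one.symm.trans_le (ENNReal.log_monotone ?_))
    (Nat.cast_nonneg' n)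
  obtain ⟨x⟩ := T.nonempty_orbits (n + 1)
  refine le_iSup₂_of_le {x} (Set.pairwise_singleton _ _) ?_
  simp [birkhoffSum]

theorem pressure_ne_bot [CompactSpace X] [Nonempty X] (φ : C(T.orbits 2, ℝ)) :
    T.pressure φ ≠ ⊥ := by
  have h : T.pressure 0 ≤ T.pressure φ + (‖φ‖ : ℝ) := T.pressure_le_add fun p => by
    simpa using neg_le_iff_add_nonneg.1 (φ.neg_norm_le_apply p)
  intro hbot
  rw [hbot, EReal.bot_add] at h
  exact absurd (T.pressure_zero_nonneg.trans h) (by simp)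

theorem pressure_ne_top [CompactSpace X] (hT : T.topEntropy < ⊤) (φ : C(T.orbits 2, ℝ)) :
    T.pressure φ ≠ ⊤ := by
  have h : T.pressure φ ≤ T.pressure 0 + (‖φ‖ : ℝ) := T.pressure_le_add fun p => by
    simpa using φ.apply_le_norm p
  exact (h.trans_lt (EReal.add_lt_top hT.ne (EReal.coe_ne_top _))).ne

end Pressure

end Correspondence

theorem exists_finset_separated_cover {Y : Type*} [PseudoMetricSpace Y] [CompactSpace Y] {ε : ℝ}
    (hε : 0 < ε) :
    ∃ E : Finset Y, ((E : Set Y).Pairwise fun x y => ε ≤ dist x y) ∧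
      ∀ y, ∃ x ∈ E, dist y x ≤ ε := by
  lift ε to NNReal using hε.le
  have hfin : Metric.packingNumber ε (Set.univ : Set Y) ≠ ⊤ := by
    obtain ⟨N, -, hN, hcov⟩ := Metric.exists_finite_isCover_of_isCompact (ε := ε / 2)
      (half_pos (NNReal.coe_pos.1 hε)).ne' (isCompact_univ (X := Y))
    have h := (Metric.packingNumber_two_mul_le_externalCoveringNumber (ε / 2) Set.univ).trans
      hcov.externalCoveringNumber_le_encard
    rw [mul_div_cancel₀ _ two_ne_zero] at h
    exact (h.trans_lt hN.encard_lt_top).ne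
  set C := Metric.maximalSeparatedSet ε (Set.univ : Set Y)
  have hC : C.Finite := by
    rwa [← Set.encard_ne_top_iff, Metric.encard_maximalSeparatedSet hfin]
  refine ⟨hC.toFinset, ?_, fun y => ?_⟩
  · rw [hC.coe_toFinset]
    intro x hx y hy hxy
    have h : (ε : ENNReal) < edist x y := Metric.isSeparated_maximalSeparatedSet hx hy hxy
    rw [edist_nndist] at h
    exact_mod_cast h.le
  · obtain ⟨x, hx, hxy⟩ := Metric.isCover_maximalSeparatedSet hfin (Set.mem_univ y)
    have h : edist y x ≤ ε := hxy
    rw [edist_nndist] at h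
    exact ⟨x, hC.mem_toFinset.2 hx, by exact_mod_cast h⟩

namespace Correspondence

variable {X : Type*} [MetricSpace X] (T : Correspondence X)

theorem log_sum_exp_le_of_log_sepSum_le {φ : C(T.orbits 2, ℝ)} {n : ℕ} {ε c : ℝ}
    (h : ENNReal.log (T.sepSum φ n ε) ≤ c) {E : Finset (T.orbits (n + 1))} (hE : E.Nonempty)
    (hsep : (E : Set (T.orbits (n + 1))).Pairwise fun x y => ε ≤ dist x y) :
    Real.log (∑ x ∈ E, Real.exp (T.birkhoffSum φ n x)) ≤ c := by
  have hsum : ENNReal.ofReal (∑ x ∈ E, Real.exp (T.birkhoffSum φ n x)) ≤ T.sepSum φ n ε := by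
    refine le_iSup₂_of_le (E : Set (T.orbits (n + 1))) hsep ?_
    rw [ENNReal.ofReal_sum_of_nonneg fun x _ => (Real.exp_pos _).le]
    exact (Finset.tsum_subtype' E
      fun x => ENNReal.ofReal (Real.exp (T.birkhoffSum φ n x))).ge
  have hlog := (ENNReal.log_monotone hsum).trans h
  rw [ENNReal.log_ofReal_of_pos (Finset.sum_pos (fun x _ => Real.exp_pos _) hE)] at hlog
  exact_mod_cast hlog

theorem eventually_exists_net_of_pressure_lt [CompactSpace X] [Nonempty X]
    {φ : C(T.orbits 2, ℝ)} {c ε : ℝ} (hc : T.pressure φ < c) (hε : 0 < ε) :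
    ∀ᶠ n : ℕ in atTop, ∃ E : Finset (T.orbits (n + 1)), (∀ y, ∃ x ∈ E, dist y x < ε) ∧
      Real.log (∑ x ∈ E, Real.exp (T.birkhoffSum φ n x)) ≤ n * c := by
  have hlt : T.pressureAt φ (ε / 2) < c :=
    (le_iSup₂_of_le (f := fun ε (_ : 0 < ε) => T.pressureAt φ ε) _ (half_pos hε)
      le_rfl).trans_lt hc
  filter_upwards [eventually_lt_of_limsup_lt hlt, eventually_gt_atTop 0] with n hn hn0
  rw [EReal.div_lt_iff (Nat.cast_pos'.2 hn0) (EReal.natCast_ne_top n)] at hn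
  obtain ⟨E, hsep, hcov⟩ := exists_finset_separated_cover (Y := T.orbits (n + 1)) (half_pos hε)
  obtain ⟨y⟩ := T.nonempty_orbits (n + 1)
  obtain ⟨x, hx, -⟩ := hcov y
  refine ⟨E, fun y => ?_, T.log_sum_exp_le_of_log_sepSum_le ?_ ⟨x, hx⟩ hsep⟩
  · obtain ⟨x, hx, hyx⟩ := hcov y
    exact ⟨x, hx, hyx.trans_lt (half_lt_self hε)⟩
  · rw [mul_comm, EReal.coe_mul]
    exact hn.le

end Correspondence

section Coding

theorem negMulLog_le_mul_neg_log_add_sub {p q : ℝ} (hp : 0 ≤ p) (hq : 0 < q) :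
    Real.negMulLog p ≤ p * -Real.log q + (q - p) := by
  obtain ⟨x, rfl⟩ : ∃ x, p = q * x := ⟨p / q, by field_simp⟩
  have hx : 0 ≤ x := nonneg_of_mul_nonneg_right hp hq
  have h := mul_le_mul_of_nonneg_left (Real.self_sub_one_le_mul_log hx) hq.le
  rw [Real.negMulLog_mul]
  simp only [Real.negMulLog]
  linarith

theorem sum_negMulLog_measureReal_preimage_le_integral {Ω α : Type*} [MeasurableSpace Ω]
    [Fintype α] [MeasurableSpace α] [MeasurableSingletonClass α] (m : Measure Ω)
    [IsProbabilityMeasure m] {f : Ω → α} (hf : Measurable f) {q : α → ℝ} (hq : ∀ a, 0 < q a)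
    (hq1 : ∑ a, q a ≤ 1) :
    ∑ a, Real.negMulLog (m.real (f ⁻¹' {a})) ≤ ∫ ω, -Real.log (q (f ω)) ∂m := by
  have := Measure.isProbabilityMeasure_map (μ := m) hf.aemeasurable
  simp only [← map_measureReal_apply hf (measurableSet_singleton _)]
  have hmass : ∑ a, (m.map f).real {a} = 1 := by simp [sum_measureReal_singleton]
  calc ∑ a, Real.negMulLog ((m.map f).real {a})
      ≤ ∑ a, ((m.map f).real {a} * -Real.log (q a) + (q a - (m.map f).real {a})) :=
        Finset.sum_le_sum fun a _ =>
          negMulLog_le_mul_neg_log_add_sub measureReal_nonneg (hq a)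
    _ ≤ ∑ a, (m.map f).real {a} * -Real.log (q a) := by
        rw [Finset.sum_add_distrib, Finset.sum_sub_distrib]
        linarith
    _ = ∫ a, -Real.log (q a) ∂(m.map f) := (integral_fintype .of_finite).symm
    _ = ∫ ω, -Real.log (q (f ω)) ∂m :=
        integral_map hf.aemeasurable (measurable_of_finite _).aestronglyMeasurable

variable {ι α β : Type*} [Fintype α] [DecidableEq α] {δ : ℝ}

/-- The probability of reading the letter `a` when `b` is sent: `b` is transmitted unchanged with
probability `1 - δ` and replaced by a uniformly random letter with probability `δ`. -/
noncomputable def noisyChannel (δ : ℝ) (a b : α) : ℝ :=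
  (if a = b then 1 - δ else 0) + δ / Fintype.card α

theorem noisyChannel_pos (hδ : 0 < δ) (hδ1 : δ < 1) (a b : α) : 0 < noisyChannel δ a b := by
  have : Nonempty α := ⟨a⟩
  have : 0 < δ / Fintype.card α := by positivity
  unfold noisyChannel
  split_ifs <;> linarith

theorem sum_noisyChannel (δ : ℝ) (b : α) : ∑ a, noisyChannel δ a b = 1 := by
  have : Nonempty α := ⟨b⟩
  simp only [noisyChannel, Finset.sum_add_distrib, Finset.sum_ite_eq', Finset.mem_univ, if_true,
    Finset.sum_const, Finset.card_univ, nsmul_eq_mul]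
  field_simp
  ring

theorem neg_log_noisyChannel_le (hδ : 0 < δ) (hδ1 : δ < 1) (a b : α) :
    -Real.log (noisyChannel δ a b) ≤
      -Real.log (1 - δ) + if a ≠ b then Real.log (Fintype.card α / δ) else 0 := by
  have : Nonempty α := ⟨a⟩
  have hδα : 0 < δ / Fintype.card α := by positivity
  have hδ0 : Real.log (1 - δ) ≤ 0 := Real.log_nonpos (by linarith) (by linarith)
  by_cases hab : a = b
  · have h := Real.log_le_log (by linarith : 0 < 1 - δ) (le_add_of_nonneg_right hδα.le)
    simpa [noisyChannel, hab] using h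
  · rw [← inv_div, Real.log_inv]
    simp only [noisyChannel, hab, if_false, zero_add, ne_eq, not_false_eq_true, if_true]
    linarith

variable [Fintype ι]

/-- The law of a random word in `ι → α`: a codeword `c x`, with `x ∈ E` chosen with probability
proportional to `exp (w x)`, is sent letter by letter through the noisy channel. -/
noncomputable def noisyCode (E : Finset β) (w : β → ℝ) (c : β → ι → α) (δ : ℝ) (a : ι → α) : ℝ :=
  (∑ x ∈ E, Real.exp (w x) * ∏ i, noisyChannel δ (a i) (c x i)) / ∑ x ∈ E, Real.exp (w x)

variable {E : Finset β} (w : β → ℝ) (c : β → ι → α)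

theorem sum_exp_pos (hE : E.Nonempty) : 0 < ∑ x ∈ E, Real.exp (w x) :=
  Finset.sum_pos (fun _ _ => Real.exp_pos _) hE

theorem prod_noisyChannel_pos (hδ : 0 < δ) (hδ1 : δ < 1) (a b : ι → α) :
    0 < ∏ i, noisyChannel δ (a i) (b i) :=
  Finset.prod_pos fun _ _ => noisyChannel_pos hδ hδ1 _ _

theorem noisyCode_pos (hE : E.Nonempty) (hδ : 0 < δ) (hδ1 : δ < 1) (a : ι → α) :
    0 < noisyCode E w c δ a :=
  div_pos (Finset.sum_pos (fun x _ => mul_pos (Real.exp_pos _)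
    (prod_noisyChannel_pos hδ hδ1 a (c x))) hE) (sum_exp_pos w hE)

theorem sum_noisyCode [DecidableEq ι] (hE : E.Nonempty) (δ : ℝ) :
    ∑ a, noisyCode E w c δ a = 1 := by
  have hword : ∀ b : ι → α, ∑ a : ι → α, ∏ i, noisyChannel δ (a i) (b i) = 1 := fun b => by
    rw [← Fintype.prod_sum fun i a => noisyChannel δ a (b i)]
    simp [sum_noisyChannel]
  simp only [noisyCode, ← Finset.sum_div]
  rw [Finset.sum_comm, div_eq_one_iff_eq (sum_exp_pos w hE).ne']
  simp only [← Finset.mul_sum, hword, mul_one]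

theorem neg_log_prod_noisyChannel_le (hδ : 0 < δ) (hδ1 : δ < 1) (a b : ι → α) :
    -Real.log (∏ i, noisyChannel δ (a i) (b i)) ≤
      Fintype.card ι * -Real.log (1 - δ) +
        Real.log (Fintype.card α / δ) * hammingDist a b := by
  calc -Real.log (∏ i, noisyChannel δ (a i) (b i))
      = ∑ i, -Real.log (noisyChannel δ (a i) (b i)) := by
        rw [Real.log_prod fun i _ => (noisyChannel_pos hδ hδ1 _ _).ne', Finset.sum_neg_distrib]
    _ ≤ ∑ i, (-Real.log (1 - δ) + if a i ≠ b i then Real.log (Fintype.card α / δ) else 0) :=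
        Finset.sum_le_sum fun i _ => neg_log_noisyChannel_le hδ hδ1 _ _
    _ = _ := by
        rw [Finset.sum_add_distrib, ← Finset.sum_filter, Finset.sum_const, Finset.sum_const,
          nsmul_eq_mul, nsmul_eq_mul, Finset.card_univ, hammingDist, mul_comm (Real.log _)]

theorem neg_log_noisyCode_le (hδ : 0 < δ) (hδ1 : δ < 1) (a : ι → α) {x : β} (hx : x ∈ E) :
    -Real.log (noisyCode E w c δ a) ≤
      Real.log (∑ x ∈ E, Real.exp (w x)) - w x + Fintype.card ι * -Real.log (1 - δ) +
        Real.log (Fintype.card α / δ) * hammingDist a (c x) := by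
  have hpos : ∀ x, 0 < Real.exp (w x) * ∏ i, noisyChannel δ (a i) (c x i) := fun x =>
    mul_pos (Real.exp_pos _) (prod_noisyChannel_pos hδ hδ1 a (c x))
  have hsum := Finset.single_le_sum
    (f := fun x => Real.exp (w x) * ∏ i, noisyChannel δ (a i) (c x i)) (fun x _ => (hpos x).le) hx
  have hlog := Real.log_le_log (hpos x) hsum
  rw [Real.log_mul (Real.exp_pos _).ne' (prod_noisyChannel_pos hδ hδ1 a (c x)).ne',
    Real.log_exp] at hlog
  rw [noisyCode, Real.log_div ((hpos x).trans_le hsum).ne' (sum_exp_pos w ⟨x, hx⟩).ne']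
  linarith [neg_log_prod_noisyChannel_le hδ hδ1 a (c x)]

theorem log_natCast_div_nonneg (hδ : 0 < δ) (hδ1 : δ ≤ 1) (k : ℕ) : 0 ≤ Real.log (k / δ) := by
  rcases k.eq_zero_or_pos with rfl | hk
  · simp
  · exact Real.log_nonneg ((one_le_div hδ).2 (hδ1.trans (Nat.one_le_cast.2 hk)))

theorem tendsto_neg_log_one_sub_add_log_div_mul {k : ℝ} (hk : 0 < k) :
    Tendsto (fun δ : ℝ => -Real.log (1 - δ) + Real.log (k / δ) * δ) (𝓝[>] 0) (𝓝 0) := by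
  have hc : ContinuousAt
      (fun δ : ℝ => -Real.log (1 - δ) + (Real.log k * δ + Real.negMulLog δ)) 0 :=
    .add (.neg (.log (by fun_prop) (by norm_num)))
      (.add (by fun_prop) Real.continuous_negMulLog.continuousAt)
  have h : Tendsto (fun δ : ℝ => -Real.log (1 - δ) + (Real.log k * δ + Real.negMulLog δ))
      (𝓝[>] 0) (𝓝 0) := by
    simpa using hc.tendsto.mono_left nhdsWithin_le_nhds
  refine h.congr' ?_
  filter_upwards [self_mem_nhdsWithin] with δ hδ
  rw [Real.log_div hk.ne' (ne_of_gt hδ), Real.negMulLog]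
  ring

end Coding

theorem exists_forall_thickening_eq {X ι : Type*} [PseudoEMetricSpace X] [Finite ι] [Nonempty ι]
    {K : ι → Set X} (hK : ∀ j, IsCompact (K j)) (hclosed : ∀ j, IsClosed (K j))
    (hdisj : Pairwise fun i j => Disjoint (K i) (K j)) :
    ∃ ε > 0, ∃ g : X → ι, ∀ j, ∀ x ∈ Metric.thickening ε (K j), g x = j := by
  have hev : ∀ᶠ ε in 𝓝[>] (0 : ℝ), ∀ i j, i ≠ j →
      Disjoint (Metric.thickening ε (K i)) (Metric.thickening ε (K j)) := by
    simp only [eventually_all]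
    intro i j hij
    obtain ⟨δ, hδ, hd⟩ := (hdisj hij).exists_thickenings (hK i) (hclosed j)
    filter_upwards [Ioo_mem_nhdsGT hδ] with ε hε
    exact hd.mono (Metric.thickening_mono hε.2.le _) (Metric.thickening_mono hε.2.le _)
  obtain ⟨ε, hε, hε0⟩ := (hev.and self_mem_nhdsWithin).exists
  have hlabel : ∀ x, ∃ i, ∀ j, x ∈ Metric.thickening ε (K j) → i = j := by
    intro x
    by_cases hx : ∃ i, x ∈ Metric.thickening ε (K i)
    · obtain ⟨i, hi⟩ := hx
      exact ⟨i, fun j hj => by_contra fun hij => Set.disjoint_left.1 (hε i j hij) hi hj⟩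
    · exact ⟨Classical.arbitrary ι, fun j hj => absurd ⟨j, hj⟩ hx⟩
  choose g hg using hlabel
  exact ⟨ε, hε0, g, fun j x hx => hg x j hx⟩

namespace FinMeasurablePartition

section Itinerary

variable {X : Type*} [MeasurableSpace X] (𝒜 : FinMeasurablePartition X)

theorem exists_mem_cell (x : X) : ∃ j, x ∈ 𝒜.cell j :=
  Set.mem_iUnion.1 (𝒜.iUnion_cell ▸ Set.mem_univ x)

/-- The index of the cell containing a point. -/
noncomputable def index (x : X) : Fin 𝒜.card := (𝒜.exists_mem_cell x).choose

theorem mem_cell_index (x : X) : x ∈ 𝒜.cell (𝒜.index x) := (𝒜.exists_mem_cell x).choose_spec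

theorem index_eq_iff {x : X} {j : Fin 𝒜.card} : 𝒜.index x = j ↔ x ∈ 𝒜.cell j := by
  refine ⟨fun h => h ▸ 𝒜.mem_cell_index x, fun h => ?_⟩
  by_contra hne
  exact Set.disjoint_left.1 (𝒜.disjoint_cell hne) (𝒜.mem_cell_index x) h

theorem measurable_index : Measurable 𝒜.index :=
  measurable_to_countable' fun j => by
    convert 𝒜.measurableSet_cell j using 1
    ext x
    exact 𝒜.index_eq_iff

/-- The itinerary of a finite sequence of points: the word formed by the indices of the cells it
visits. -/
noncomputable def itinerary {n : ℕ} (y : Fin n → X) : Fin n → Fin 𝒜.card :=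
  fun i => 𝒜.index (y i)

theorem measurable_itinerary {n : ℕ} : Measurable (𝒜.itinerary (n := n)) :=
  measurable_pi_lambda _ fun i => 𝒜.measurable_index.comp (measurable_pi_apply i)

theorem preimage_itinerary_singleton {n : ℕ} (a : Fin n → Fin 𝒜.card) :
    𝒜.itinerary ⁻¹' {a} = Set.univ.pi fun i => 𝒜.cell (a i) := by
  ext y
  simp [itinerary, funext_iff, index_eq_iff]

theorem powEntropy_le_of_shadowing {n : ℕ} (m : Measure (Fin n → X)) [IsProbabilityMeasure m]
    {β : Type*} {E : Finset β} {w : β → ℝ} {c : β → Fin n → Fin 𝒜.card} {δ : ℝ} (hδ : 0 < δ)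
    (hδ1 : δ < 1) {F N : (Fin n → X) → ℝ} (hF : Integrable F m) (hN : Integrable N m)
    (hshadow : ∀ᵐ y ∂m, ∃ x ∈ E, F y ≤ w x ∧ hammingDist (𝒜.itinerary y) (c x) ≤ N y) :
    𝒜.powEntropy n m ≤ Real.log (∑ x ∈ E, Real.exp (w x)) - ∫ y, F y ∂m +
      n * -Real.log (1 - δ) + Real.log (𝒜.card / δ) * ∫ y, N y ∂m := by
  have hE : E.Nonempty := by
    obtain ⟨y, x, hx, -⟩ := hshadow.exists
    exact ⟨x, hx⟩
  have hlogδ : 0 ≤ Real.log (𝒜.card / δ) := log_natCast_div_nonneg hδ hδ1.le _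
  set q := noisyCode E w c δ
  set G : (Fin n → X) → ℝ := fun y => Real.log (∑ x ∈ E, Real.exp (w x)) - F y +
    n * -Real.log (1 - δ) + Real.log (𝒜.card / δ) * N y
  have hq : Integrable (fun y => -Real.log (q (𝒜.itinerary y))) m :=
    (Integrable.of_finite (μ := m.map 𝒜.itinerary)
      (f := fun a => -Real.log (q a))).comp_measurable 𝒜.measurable_itinerary
  have hG : Integrable G m := by fun_prop
  calc 𝒜.powEntropy n m
      = ∑ a, Real.negMulLog (m.real (𝒜.itinerary ⁻¹' {a})) := by
        simp only [powEntropy, preimage_itinerary_singleton]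
    _ ≤ ∫ y, -Real.log (q (𝒜.itinerary y)) ∂m :=
        sum_negMulLog_measureReal_preimage_le_integral m 𝒜.measurable_itinerary
          (noisyCode_pos w c hE hδ hδ1) (sum_noisyCode w c hE δ).le
    _ ≤ ∫ y, G y ∂m := by
        refine integral_mono_ae hq hG ?_
        filter_upwards [hshadow] with y ⟨x, hx, hFw, hd⟩
        have hcode := neg_log_noisyCode_le w c hδ hδ1 (𝒜.itinerary y) hx
        rw [Fintype.card_fin, Fintype.card_fin] at hcode
        linarith [mul_le_mul_of_nonneg_left hd hlogδ]
    _ = _ := by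
        simp only [G]
        rw [integral_add (by fun_prop) (by fun_prop), integral_add (by fun_prop) (by fun_prop),
          integral_sub (by fun_prop) hF, integral_const_mul (Real.log _)]
        simp only [integral_const, probReal_univ, one_smul]

end Itinerary

theorem exists_isCompact_subset_cell {X : Type*} [TopologicalSpace X] [T2Space X]
    [MeasurableSpace X] [OpensMeasurableSpace X] (𝒜 : FinMeasurablePartition X) (μ : Measure X)
    [IsFiniteMeasure μ] [μ.InnerRegularCompactLTTop] {δ : ℝ} (hδ : 0 < δ) :
    ∃ K : Fin 𝒜.card → Set X, (∀ j, IsCompact (K j)) ∧ (∀ j, K j ⊆ 𝒜.cell j) ∧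
      μ.real (⋃ j, K j)ᶜ ≤ δ := by
  have hη : 0 < δ / (𝒜.card + 1) := by positivity
  choose K hKsub hK hμK using fun j => (𝒜.measurableSet_cell j).exists_isCompact_sdiff_lt (μ := μ)
    (measure_ne_top _ _) (ENNReal.ofReal_pos.2 hη).ne'
  refine ⟨K, hK, hKsub, ?_⟩
  have hsub : (⋃ j, K j)ᶜ ⊆ ⋃ j, 𝒜.cell j \ K j := fun x hx =>
    Set.mem_iUnion.2 ⟨𝒜.index x, 𝒜.mem_cell_index x, fun hxK => hx (Set.mem_iUnion_of_mem _ hxK)⟩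
  calc μ.real (⋃ j, K j)ᶜ ≤ μ.real (⋃ j, 𝒜.cell j \ K j) := measureReal_mono hsub
    _ ≤ ∑ j, μ.real (𝒜.cell j \ K j) := measureReal_iUnion_fintype_le _
    _ ≤ ∑ _j : Fin 𝒜.card, δ / (𝒜.card + 1) := Finset.sum_le_sum fun j _ =>
        ENNReal.toReal_le_of_le_ofReal hη.le (hμK j).le
    _ = 𝒜.card * (δ / (𝒜.card + 1)) := by simp
    _ ≤ (𝒜.card + 1) * (δ / (𝒜.card + 1)) := by gcongr; linarith
    _ = δ := by field_simp

theorem exists_label_eq_index_of_dist_lt {X : Type*} [MetricSpace X] [Nonempty X]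
    [MeasurableSpace X] [OpensMeasurableSpace X] (𝒜 : FinMeasurablePartition X) (μ : Measure X)
    [IsFiniteMeasure μ] [μ.InnerRegularCompactLTTop] {δ : ℝ} (hδ : 0 < δ) :
    ∃ K, MeasurableSet K ∧ μ.real Kᶜ ≤ δ ∧ ∃ ε > 0, ∃ g : X → Fin 𝒜.card,
      ∀ y ∈ K, ∀ x, dist y x < ε → 𝒜.index y = g x := by
  have : Nonempty (Fin 𝒜.card) := ‹Nonempty X›.map 𝒜.index
  obtain ⟨K, hK, hKsub, hμK⟩ := 𝒜.exists_isCompact_subset_cell μ hδ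
  obtain ⟨ε, hε, g, hg⟩ := exists_forall_thickening_eq hK (fun j => (hK j).isClosed)
    fun i j hij => (𝒜.disjoint_cell hij).mono (hKsub i) (hKsub j)
  refine ⟨⋃ j, K j, .iUnion fun j => (hK j).measurableSet, hμK, ε, hε, g, fun y hy x hyx => ?_⟩
  obtain ⟨j, hj⟩ := Set.mem_iUnion.1 hy
  rw [𝒜.index_eq_iff.2 (hKsub j hj)]
  exact (hg j x (Metric.mem_thickening_iff.2 ⟨y, hj, by rwa [dist_comm]⟩)).symm

theorem hammingDist_itinerary_le {X : Type*} [MeasurableSpace X] (𝒜 : FinMeasurablePartition X)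
    {K : Set X} {n : ℕ} {y : Fin n → X} {b : Fin n → Fin 𝒜.card}
    (h : ∀ i, y i ∈ K → 𝒜.index (y i) = b i) :
    (hammingDist (𝒜.itinerary y) b : ℝ) ≤ ∑ i, Kᶜ.indicator 1 (y i) := by
  rw [hammingDist, Finset.card_filter]
  push_cast
  refine Finset.sum_le_sum fun i _ => ?_
  by_cases hi : y i ∈ K
  · simp [itinerary, h i hi, hi]
  · simp only [Set.indicator_of_mem (Set.mem_compl hi), Pi.one_apply]
    split_ifs <;> norm_num

end FinMeasurablePartition

section PathLaw

variable {X : Type*} [MeasurableSpace X] (Q : Kernel X X) [IsMarkovKernel Q]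
  (μ : Measure X) [SFinite μ]

theorem bind_kernelPath_succ (n : ℕ) :
    μ.bind (kernelPath Q (n + 1)) =
      (μ.bind (kernelPath Q n) ⊗ₘ Q.comap (fun y => y (Fin.last n)) (measurable_pi_apply _)).map
        (fun p => (Fin.snoc p.1 p.2 : Fin (n + 2) → X)) := by
  ext A hA
  have hA' := measurable_snoc (n + 1) hA
  rw [Measure.bind_apply hA (Kernel.aemeasurable _), Measure.map_apply (measurable_snoc _) hA,
    Measure.compProd_apply hA', Measure.lintegral_bind (Kernel.aemeasurable _)
      (Kernel.measurable_kernel_prodMk_left hA').aemeasurable]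
  simp only [kernelPath_succ_apply Q n _ hA]
  rfl

theorem map_init_bind_kernelPath_succ (n : ℕ) :
    (μ.bind (kernelPath Q (n + 1))).map (fun y (i : Fin (n + 1)) => y i.castSucc) =
      μ.bind (kernelPath Q n) := by
  rw [bind_kernelPath_succ, Measure.map_map (by fun_prop) (measurable_snoc _)]
  simp only [Function.comp_def, Fin.snoc_castSucc]
  exact Measure.fst_compProd _ _

theorem map_zero_bind_kernelPath (n : ℕ) :
    (μ.bind (kernelPath Q n)).map (fun y => y 0) = μ := by
  induction n with
  | zero =>
    rw [kernelPath, Measure.deterministic_comp_eq_map, Measure.map_map (by fun_prop) (by fun_prop)]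
    exact Measure.map_id
  | succ n ih =>
    rwa [← map_init_bind_kernelPath_succ, Measure.map_map (by fun_prop) (by fun_prop)] at ih

theorem map_prodMap_compProd_comap {Y Z : Type*} [MeasurableSpace Y] [MeasurableSpace Z]
    (ν : Measure Y) [SFinite ν] (κ : Kernel X Z) [IsSFiniteKernel κ] {f : Y → X}
    (hf : Measurable f) :
    (ν ⊗ₘ κ.comap f hf).map (Prod.map f id) = ν.map f ⊗ₘ κ := by
  ext A hA
  have hfA : MeasurableSet (Prod.map f id ⁻¹' A) := hA.preimage (by fun_prop)
  rw [Measure.map_apply (by fun_prop) hA, Measure.compProd_apply hA, Measure.compProd_apply hfA,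
    lintegral_map (Kernel.measurable_kernel_prodMk_left hA) hf]
  rfl

theorem map_last_pair_bind_kernelPath_succ (n : ℕ) :
    (μ.bind (kernelPath Q (n + 1))).map (fun y => (y (Fin.last n).castSucc, y (Fin.last n).succ)) =
      (μ.bind (kernelPath Q n)).map (fun y => y (Fin.last n)) ⊗ₘ Q := by
  rw [bind_kernelPath_succ, Measure.map_map (by fun_prop) (measurable_snoc _)]
  simp only [Function.comp_def, Fin.snoc_castSucc, Fin.succ_last, Fin.snoc_last]
  exact map_prodMap_compProd_comap _ Q (f := fun y : Fin (n + 1) → X => y (Fin.last n))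
    (measurable_pi_apply _)

theorem map_pair_bind_kernelPath (n : ℕ) (i : Fin n) :
    (μ.bind (kernelPath Q n)).map (fun y => (y i.castSucc, y i.succ)) =
      (μ.bind (kernelPath Q n)).map (fun y => y i.castSucc) ⊗ₘ Q := by
  induction n with
  | zero => exact i.elim0
  | succ n ih =>
    induction i using Fin.lastCases with
    | last =>
      rw [map_last_pair_bind_kernelPath_succ, ← map_init_bind_kernelPath_succ,
        Measure.map_map (by fun_prop) (by fun_prop)]
      rfl
    | cast j =>
      have h := ih j
      rwa [← map_init_bind_kernelPath_succ, Measure.map_map (by fun_prop) (by fun_prop),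
        Measure.map_map (by fun_prop) (by fun_prop)] at h

variable {Q μ}

theorem map_eval_bind_kernelPath (hμ : Q.Invariant μ) (n : ℕ) (i : Fin (n + 1)) :
    (μ.bind (kernelPath Q n)).map (fun y => y i) = μ := by
  induction i using Fin.induction with
  | zero => exact map_zero_bind_kernelPath Q μ n
  | succ i ih =>
    calc (μ.bind (kernelPath Q n)).map (fun y => y i.succ)
        = ((μ.bind (kernelPath Q n)).map (fun y => (y i.castSucc, y i.succ))).snd := by
          rw [Measure.snd, Measure.map_map (by fun_prop) (by fun_prop)]
          rfl
      _ = μ := by rw [map_pair_bind_kernelPath, ih, Measure.snd_compProd, hμ]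

theorem map_pair_bind_kernelPath_of_invariant (hμ : Q.Invariant μ) (n : ℕ) (i : Fin n) :
    (μ.bind (kernelPath Q n)).map (fun y => (y i.castSucc, y i.succ)) = μ ⊗ₘ Q := by
  rw [map_pair_bind_kernelPath, map_eval_bind_kernelPath hμ]

end PathLaw

section IdentDistrib

variable {Ω Y ι : Type*} [MeasurableSpace Ω] [MeasurableSpace Y] [Fintype ι] {P : Measure Ω}
  {ν : Measure Y} {g : ι → Ω → Y} {f : Y → ℝ}

theorem integrable_sum_comp_of_map_eq (hg : ∀ i, Measurable (g i)) (hν : ∀ i, P.map (g i) = ν)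
    (hf : Integrable f ν) : Integrable (fun ω => ∑ i, f (g i ω)) P :=
  integrable_finsetSum _ fun i _ => ((hν i).symm ▸ hf).comp_measurable (hg i)

theorem integral_sum_comp_of_map_eq (hg : ∀ i, Measurable (g i)) (hν : ∀ i, P.map (g i) = ν)
    (hf : Integrable f ν) : ∫ ω, ∑ i, f (g i ω) ∂P = Fintype.card ι * ∫ y, f y ∂ν := by
  have hfi : ∀ i, Integrable f (P.map (g i)) := fun i => (hν i).symm ▸ hf
  calc ∫ ω, ∑ i, f (g i ω) ∂P = ∑ i, ∫ ω, f (g i ω) ∂P :=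
        integral_finsetSum _ fun i _ => (hfi i).comp_measurable (hg i)
    _ = ∑ i, ∫ y, f y ∂(P.map (g i)) := Finset.sum_congr rfl fun i _ =>
        (integral_map (hg i).aemeasurable (hfi i).aestronglyMeasurable).symm
    _ = Fintype.card ι * ∫ y, f y ∂ν := by simp [hν]

end IdentDistrib

namespace Correspondence

section Restrict

variable {X : Type*} [TopologicalSpace X] (T : Correspondence X)

/-- The restriction to `𝒪_2(T)` of a continuous function on `X × X`. -/
def restrict (Φ : C(X × X, ℝ)) : C(T.orbits 2, ℝ) :=
  (Φ.comp ⟨fun y : Fin 2 → X => (y 0, y 1), by fun_prop⟩).restrict (T.orbits 2)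

@[simp]
theorem restrict_apply (Φ : C(X × X, ℝ)) (p : T.orbits 2) :
    T.restrict Φ p = Φ (p.1 0, p.1 1) := rfl

theorem birkhoffSum_restrict (Φ : C(X × X, ℝ)) (n : ℕ) (x : T.orbits (n + 1)) :
    T.birkhoffSum (T.restrict Φ) n x = ∑ i : Fin n, Φ (x.1 i.castSucc, x.1 i.succ) := rfl

end Restrict

theorem ae_mem_apply {X : Type*} [TopologicalSpace X] [MeasurableSpace X]
    [OpensMeasurableSpace X] (T : Correspondence X) {Q : Kernel X X} [IsMarkovKernel Q]
    (hQ : T.Supports Q) (x : X) : ∀ᵐ y ∂(Q x), y ∈ T x :=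
  (prob_compl_eq_zero_iff (T.isClosed' x).measurableSet).2 (hQ x)

section Metric

variable {X : Type*} [MetricSpace X] (T : Correspondence X)

theorem restrict_surjective : Function.Surjective T.restrict := by
  intro φ
  obtain ⟨Ψ, hΨ⟩ := ContinuousMap.exists_restrict_eq (T.isClosed_orbits 2) φ
  refine ⟨⟨fun p => Ψ ![p.1, p.2], by fun_prop⟩, ?_⟩
  ext p
  rw [← hΨ, restrict_apply, ContinuousMap.restrict_apply, ContinuousMap.coe_mk]
  congr 1
  ext i
  fin_cases i <;> rfl

variable [SecondCountableTopology X] [MeasurableSpace X] [BorelSpace X] {Q : Kernel X X}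
  [IsMarkovKernel Q] {μ : Measure X} [SFinite μ]

theorem ae_mem_of_supports (hQ : T.Supports Q) : ∀ᵐ p ∂(μ ⊗ₘ Q), p.2 ∈ T p.1 := by
  rw [Measure.ae_compProd_iff T.isClosed_graph.measurableSet]
  exact .of_forall (T.ae_mem_apply hQ)

theorem ae_mem_orbits (hQ : T.Supports Q) (n : ℕ) :
    ∀ᵐ y ∂(μ.bind (kernelPath Q n)), y ∈ T.orbits (n + 1) := by
  simp only [mem_orbits_succ_iff]
  refine ae_all_iff.2 fun i => ?_
  have hpair := T.ae_mem_of_supports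
    (μ := (μ.bind (kernelPath Q n)).map fun y => y i.castSucc) hQ
  rw [← map_pair_bind_kernelPath] at hpair
  exact ae_of_ae_map (by fun_prop) hpair

theorem orbitIntegral_restrict (hQ : T.Supports Q) (Φ : C(X × X, ℝ)) :
    T.orbitIntegral (T.restrict Φ) Q μ = ∫ p, Φ p ∂(μ ⊗ₘ Q) := by
  have hlaw : (μ.bind (kernelPath Q 1)).map (fun y => (y 0, y 1)) = μ ⊗ₘ Q := by
    have h := map_pair_bind_kernelPath Q μ 1 0
    rwa [Fin.castSucc_zero, Fin.succ_zero_eq_one, map_zero_bind_kernelPath] at h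
  calc T.orbitIntegral (T.restrict Φ) Q μ
      = ∫ y in T.orbits 2, Φ (y 0, y 1) ∂(μ.bind (kernelPath Q 1)) :=
        integral_subtype_comap (T.isClosed_orbits 2).measurableSet fun y => Φ (y 0, y 1)
    _ = ∫ y, Φ (y 0, y 1) ∂(μ.bind (kernelPath Q 1)) := by
        rw [Measure.restrict_eq_self_of_ae_mem (T.ae_mem_orbits hQ 1)]
    _ = ∫ p, Φ p ∂(μ ⊗ₘ Q) := by
        rw [← hlaw, integral_map (by fun_prop) Φ.continuous.measurable.aestronglyMeasurable]

end Metric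

section Compact

variable {X : Type*} [MetricSpace X] [CompactSpace X] [MeasurableSpace X] [BorelSpace X]
  (T : Correspondence X) {Q : Kernel X X} [IsMarkovKernel Q] {μ : Measure X} [IsFiniteMeasure μ]

theorem integrable_compProd (Φ : C(X × X, ℝ)) : Integrable Φ (μ ⊗ₘ Q) :=
  Φ.continuous.integrable_of_hasCompactSupport (.of_compactSpace _)

theorem doubleIntegral_restrict (hQ : T.Supports Q) (Φ : C(X × X, ℝ)) :
    T.doubleIntegral (T.restrict Φ) Q μ = ∫ p, Φ p ∂(μ ⊗ₘ Q) := by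
  rw [Measure.integral_compProd (integrable_compProd Φ), doubleIntegral]
  congr 1 with x
  calc ∫ y : T x, Φ (x, y) ∂((Q x).comap Subtype.val)
      = ∫ y in T x, Φ (x, y) ∂(Q x) :=
        integral_subtype_comap (T.isClosed' x).measurableSet fun y => Φ (x, y)
    _ = ∫ y, Φ (x, y) ∂(Q x) := by
        rw [Measure.restrict_eq_self_of_ae_mem (T.ae_mem_apply hQ x)]

theorem orbitIntegral_eq_doubleIntegral (hQ : T.Supports Q) (φ : C(T.orbits 2, ℝ)) :
    T.orbitIntegral φ Q μ = T.doubleIntegral φ Q μ := by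
  obtain ⟨Φ, rfl⟩ := T.restrict_surjective φ
  rw [T.orbitIntegral_restrict hQ, T.doubleIntegral_restrict hQ]

theorem doubleIntegral_add (hQ : T.Supports Q) (φ ψ : C(T.orbits 2, ℝ)) :
    T.doubleIntegral (φ + ψ) Q μ = T.doubleIntegral φ Q μ + T.doubleIntegral ψ Q μ := by
  obtain ⟨Φ, rfl⟩ := T.restrict_surjective φ
  obtain ⟨Ψ, rfl⟩ := T.restrict_surjective ψ
  rw [T.doubleIntegral_restrict hQ, T.doubleIntegral_restrict hQ,
    ← integral_add (integrable_compProd Φ) (integrable_compProd Ψ)]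
  exact T.doubleIntegral_restrict hQ (Φ + Ψ)

theorem doubleIntegral_neg (hQ : T.Supports Q) (φ : C(T.orbits 2, ℝ)) :
    T.doubleIntegral (-φ) Q μ = -T.doubleIntegral φ Q μ := by
  obtain ⟨Φ, rfl⟩ := T.restrict_surjective φ
  rw [T.doubleIntegral_restrict hQ, ← integral_neg]
  exact T.doubleIntegral_restrict hQ (-Φ)

theorem doubleIntegral_const (hQ : T.Supports Q) (c : ℝ) :
    T.doubleIntegral (ContinuousMap.const _ c) Q μ = μ.real Set.univ * c := by
  refine (T.doubleIntegral_restrict hQ (ContinuousMap.const _ c)).trans ?_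
  simp [measureReal_def]

end Compact

end Correspondence

theorem add_coe_le_coe_iff {h : EReal} {a c : ℝ} : h + a ≤ c ↔ h ≤ ((c - a : ℝ) : EReal) := by
  rw [EReal.coe_sub, EReal.le_sub_iff_add_le (.inl (EReal.coe_ne_bot _))
    (.inl (EReal.coe_ne_top _))]

namespace Correspondence

theorem sum_le_birkhoffSum_restrict_add {X : Type*} [PseudoMetricSpace X] (T : Correspondence X)
    {Φ : C(X × X, ℝ)} {ε ω : ℝ} (hΦ : ∀ p q, dist p q < ε → Φ p ≤ Φ q + ω) {n : ℕ}
    {y : Fin (n + 1) → X} {x : T.orbits (n + 1)} (hyx : dist y x < ε) :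
    ∑ i : Fin n, Φ (y i.castSucc, y i.succ) ≤ T.birkhoffSum (T.restrict Φ) n x + n * ω := by
  have hdist : ∀ i, dist (y i) (x.1 i) < ε := fun i => (dist_le_pi_dist y x i).trans_lt hyx
  calc ∑ i : Fin n, Φ (y i.castSucc, y i.succ)
      ≤ ∑ i : Fin n, (Φ (x.1 i.castSucc, x.1 i.succ) + ω) :=
        Finset.sum_le_sum fun i _ => hΦ _ _ (max_lt (hdist _) (hdist _))
    _ = T.birkhoffSum (T.restrict Φ) n x + n * ω := by
        simp [Finset.sum_add_distrib, birkhoffSum_restrict]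

section VariationalInequality

variable {X : Type*} [MetricSpace X] [CompactSpace X] [MeasurableSpace X] [BorelSpace X]
  (T : Correspondence X) {Q : Kernel X X} [IsMarkovKernel Q] {μ : Measure X}
  [IsProbabilityMeasure μ]

theorem powEntropy_le_of_net (hQ : T.Supports Q) (hμ : Q.Invariant μ)
    {𝒜 : FinMeasurablePartition X} {Φ : C(X × X, ℝ)} {δ ε ω : ℝ} (hδ : 0 < δ) (hδ1 : δ < 1)
    {K : Set X} (hK : MeasurableSet K) {g : X → Fin 𝒜.card}
    (hg : ∀ y ∈ K, ∀ x, dist y x < ε → 𝒜.index y = g x)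
    (hΦ : ∀ p q, dist p q < ε → Φ p ≤ Φ q + ω) {n : ℕ} {E : Finset (T.orbits (n + 1))}
    (hE : ∀ y, ∃ x ∈ E, dist y x < ε) :
    𝒜.powEntropy (n + 1) (μ.bind (kernelPath Q n)) ≤
      Real.log (∑ x ∈ E, Real.exp (T.birkhoffSum (T.restrict Φ) n x)) -
        n * (∫ p, Φ p ∂(μ ⊗ₘ Q) - ω) +
        (n + 1) * (-Real.log (1 - δ) + Real.log (𝒜.card / δ) * μ.real Kᶜ) := by
  set P := μ.bind (kernelPath Q n)
  have hΦω : Integrable (fun p => Φ p - ω) (μ ⊗ₘ Q) :=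
    (integrable_compProd Φ).sub (integrable_const ω)
  have hKc : Integrable (Kᶜ.indicator (1 : X → ℝ)) μ := (integrable_const 1).indicator hK.compl
  have hpair := map_pair_bind_kernelPath_of_invariant hμ n
  have heval := map_eval_bind_kernelPath hμ n
  have hshadow : ∀ᵐ y ∂P, ∃ x ∈ E,
      ∑ i : Fin n, (Φ (y i.castSucc, y i.succ) - ω) ≤ T.birkhoffSum (T.restrict Φ) n x ∧
        (hammingDist (𝒜.itinerary y) (fun i => g (x.1 i)) : ℝ) ≤ ∑ i, Kᶜ.indicator 1 (y i) := by
    filter_upwards [T.ae_mem_orbits hQ n] with y hy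
    obtain ⟨x, hxE, hyx⟩ := hE ⟨y, hy⟩
    refine ⟨x, hxE, ?_, 𝒜.hammingDist_itinerary_le fun i hi =>
      hg _ hi _ ((dist_le_pi_dist y x i).trans_lt hyx)⟩
    simpa [Finset.sum_sub_distrib] using T.sum_le_birkhoffSum_restrict_add hΦ hyx
  refine (𝒜.powEntropy_le_of_shadowing P hδ hδ1
    (integrable_sum_comp_of_map_eq (by fun_prop) hpair hΦω)
    (integrable_sum_comp_of_map_eq (by fun_prop) heval hKc) hshadow).trans_eq ?_
  rw [integral_sum_comp_of_map_eq (by fun_prop) hpair hΦω,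
    integral_sum_comp_of_map_eq (by fun_prop) heval hKc,
    integral_sub (integrable_compProd Φ) (integrable_const ω), integral_indicator_one hK.compl]
  simp only [Fintype.card_fin, integral_const, probReal_univ, one_smul, Nat.cast_add, Nat.cast_one]
  ring

theorem exists_forall_net_powEntropy_le (hQ : T.Supports Q) (hμ : Q.Invariant μ)
    (𝒜 : FinMeasurablePartition X) (φ : C(T.orbits 2, ℝ)) {ω : ℝ} (hω : 0 < ω) :
    ∃ ε > 0, ∀ (n : ℕ) (E : Finset (T.orbits (n + 1))), (∀ y, ∃ x ∈ E, dist y x < ε) →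
      𝒜.powEntropy (n + 1) (μ.bind (kernelPath Q n)) ≤
        Real.log (∑ x ∈ E, Real.exp (T.birkhoffSum φ n x)) -
          n * (T.doubleIntegral φ Q μ - ω) + (n + 1) * ω := by
  obtain ⟨Φ, rfl⟩ := T.restrict_surjective φ
  have : Nonempty X := nonempty_of_isProbabilityMeasure μ
  have hcard : 0 < 𝒜.card := (𝒜.index (Classical.arbitrary X)).pos
  obtain ⟨δ, hδω, hδ, hδ1⟩ : ∃ δ : ℝ,
      -Real.log (1 - δ) + Real.log (𝒜.card / δ) * δ < ω ∧ 0 < δ ∧ δ < 1 :=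
    (((tendsto_neg_log_one_sub_add_log_div_mul (Nat.cast_pos.2 hcard)).eventually_lt_const
      hω).and (Ioo_mem_nhdsGT one_pos)).exists
  obtain ⟨K, hK, hμK, ε₁, hε₁, g, hg⟩ := 𝒜.exists_label_eq_index_of_dist_lt μ hδ
  obtain ⟨ε₂, hε₂, hΦ⟩ := Metric.uniformContinuous_iff.1
    (CompactSpace.uniformContinuous_of_continuous Φ.continuous) ω hω
  refine ⟨min ε₁ ε₂, lt_min hε₁ hε₂, fun n E hE => ?_⟩
  have hmodulus : ∀ p q, dist p q < min ε₁ ε₂ → Φ p ≤ Φ q + ω := fun p q hpq => by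
    linarith [(abs_lt.1 (hΦ (hpq.trans_le (min_le_right _ _)))).2]
  have hentropy := T.powEntropy_le_of_net hQ hμ hδ hδ1 hK
    (fun y hy x hyx => hg y hy x (hyx.trans_le (min_le_left _ _))) hmodulus hE
  have hnoise : -Real.log (1 - δ) + Real.log (𝒜.card / δ) * μ.real Kᶜ ≤ ω :=
    (add_le_add_right (mul_le_mul_of_nonneg_left hμK
      (log_natCast_div_nonneg hδ hδ1.le _)) _).trans hδω.le
  rw [T.doubleIntegral_restrict hQ]
  refine hentropy.trans ?_
  gcongr

theorem kernelEntropyOf_le_of_pressure_lt (hQ : T.Supports Q) (hμ : Q.Invariant μ)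
    (𝒜 : FinMeasurablePartition X) {φ : C(T.orbits 2, ℝ)} {c : ℝ} (hc : T.pressure φ < c)
    {ω : ℝ} (hω : 0 < ω) :
    kernelEntropyOf Q μ 𝒜 ≤ ((c - T.doubleIntegral φ Q μ + 2 * ω : ℝ) : EReal) := by
  have : Nonempty X := nonempty_of_isProbabilityMeasure μ
  set I := T.doubleIntegral φ Q μ
  obtain ⟨ε, hε, hentropy⟩ := T.exists_forall_net_powEntropy_le hQ hμ 𝒜 φ hω
  have hbound : ∀ᶠ n : ℕ in atTop,
      𝒜.powEntropy (n + 1) (μ.bind (kernelPath Q n)) / ((n : ℝ) + 1) ≤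
        (n : ℝ) / (n + 1) * (c - I + ω) + ω := by
    filter_upwards [T.eventually_exists_net_of_pressure_lt hc hε] with n ⟨E, hE, hlog⟩
    calc 𝒜.powEntropy (n + 1) (μ.bind (kernelPath Q n)) / ((n : ℝ) + 1)
        ≤ (n * c - n * (I - ω) + (n + 1) * ω) / (n + 1) := by
          gcongr
          linarith [hentropy n E hE]
      _ = (n : ℝ) / (n + 1) * (c - I + ω) + ω := by field_simp; ring
  have hlim : Tendsto (fun n : ℕ => (n : ℝ) / (n + 1) * (c - I + ω) + ω) atTop
      (𝓝 (c - I + 2 * ω)) := by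
    convert ((tendsto_natCast_div_add_atTop (1 : ℝ)).mul_const (c - I + ω)).add_const ω using 2
    ring
  calc kernelEntropyOf Q μ 𝒜
      ≤ limsup (fun n : ℕ => (((n : ℝ) / (n + 1) * (c - I + ω) + ω : ℝ) : EReal)) atTop :=
        limsup_le_limsup (hbound.mono fun n hn => EReal.coe_le_coe_iff.2 hn)
    _ = _ := (EReal.tendsto_coe.2 hlim).limsup_eq

theorem kernelEntropy_add_doubleIntegral_le (hQ : T.Supports Q) (hμ : Q.Invariant μ)
    (φ : C(T.orbits 2, ℝ)) :
    kernelEntropy Q μ + (T.doubleIntegral φ Q μ : EReal) ≤ T.pressure φ := by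
  refine EReal.le_of_forall_lt_iff_le.1 fun c hc => ?_
  rw [add_coe_le_coe_iff]
  refine iSup_le fun 𝒜 => EReal.le_of_forall_lt_iff_le.1 fun z hz => ?_
  have hω : 0 < (z - (c - T.doubleIntegral φ Q μ)) / 2 :=
    half_pos (sub_pos.2 (EReal.coe_lt_coe_iff.1 hz))
  refine (T.kernelEntropyOf_le_of_pressure_lt hQ hμ 𝒜 hc hω).trans_eq ?_
  congr 1
  ring

theorem kernelEntropy_le_abstractEntropy (hQ : T.Supports Q) (hμ : Q.Invariant μ) :
    kernelEntropy Q μ ≤ T.abstractEntropy Q μ := by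
  refine le_iInf₂ fun ψ hψ => ?_
  have h := (T.kernelEntropy_add_doubleIntegral_le hQ hμ (-ψ)).trans hψ
  rwa [← EReal.coe_zero, add_coe_le_coe_iff, T.doubleIntegral_neg hQ, zero_sub, neg_neg] at h

end VariationalInequality

section EquilibriumStates

variable {X : Type*} [MetricSpace X] [CompactSpace X] [MeasurableSpace X] [BorelSpace X]
  (T : Correspondence X)

theorem abstractEntropy_add_doubleIntegral_le {Q : Kernel X X} [IsMarkovKernel Q] {μ : Measure X}
    [IsProbabilityMeasure μ] (hQ : T.Supports Q) (φ : C(T.orbits 2, ℝ)) :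
    T.abstractEntropy Q μ + (T.doubleIntegral φ Q μ : EReal) ≤ T.pressure φ := by
  refine EReal.le_of_forall_lt_iff_le.1 fun c hc => ?_
  rw [add_coe_le_coe_iff]
  refine iInf₂_le_of_le (ContinuousMap.const _ c + -φ) ?_ ?_
  · calc T.pressure (-(ContinuousMap.const _ c + -φ))
        ≤ T.pressure φ + ((-c : ℝ) : EReal) := T.pressure_le_add fun x => by simp
      _ ≤ c + ((-c : ℝ) : EReal) := by gcongr
      _ = 0 := by rw [← EReal.coe_add, add_neg_cancel, EReal.coe_zero]
  · rw [T.doubleIntegral_add hQ, T.doubleIntegral_const hQ, T.doubleIntegral_neg hQ,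
      probReal_univ, one_mul, ← sub_eq_add_neg]

variable {T} {φ : C(T.orbits 2, ℝ)}

theorem mem_typeIIEquilibriumStates_iff {p : Kernel X X × Measure X} :
    p ∈ T.typeIIEquilibriumStates φ ↔ p ∈ T.admissiblePairs ∧ ∀ ψ : C(T.orbits 2, ℝ),
      T.pressure φ + (T.doubleIntegral ψ p.1 p.2 : EReal) ≤ T.pressure (φ + ψ) := by
  refine and_congr_right fun ⟨_, hQ, _⟩ => ⟨fun h ψ => ?_, fun h => le_antisymm ?_ ?_⟩
  · rw [h, add_assoc, ← EReal.coe_add, ← T.doubleIntegral_add hQ]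
    exact T.abstractEntropy_add_doubleIntegral_le hQ (φ + ψ)
  · rw [← EReal.sub_le_iff_le_add (.inl (EReal.coe_ne_bot _)) (.inl (EReal.coe_ne_top _))]
    refine le_iInf₂ fun χ hχ => ?_
    have hψ : T.pressure φ + (T.doubleIntegral (-χ + -φ) p.1 p.2 : EReal) ≤ (0 : ℝ) := by
      refine (h (-χ + -φ)).trans ?_
      rwa [add_neg_cancel_comm_assoc]
    rw [add_coe_le_coe_iff, T.doubleIntegral_add hQ, T.doubleIntegral_neg hQ,
      T.doubleIntegral_neg hQ] at hψ
    refine EReal.sub_le_of_le_add (hψ.trans_eq ?_)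
    rw [← EReal.coe_add]
    congr 1
    ring
  · exact T.abstractEntropy_add_doubleIntegral_le hQ φ

theorem mem_tangentFunctionals_iff (hT : T.topEntropy < ⊤) {p : Kernel X X × Measure X} :
    p ∈ T.tangentFunctionals φ ↔ p ∈ T.admissiblePairs ∧ ∀ ψ : C(T.orbits 2, ℝ),
      T.pressure φ + (T.doubleIntegral ψ p.1 p.2 : EReal) ≤ T.pressure (φ + ψ) := by
  refine and_congr_right fun ⟨_, hQ, _⟩ => forall_congr' fun ψ => ?_
  have : Nonempty X := nonempty_of_isProbabilityMeasure p.2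
  rw [ge_iff_le, T.orbitIntegral_eq_doubleIntegral hQ, EReal.le_sub_iff_add_le
    (.inl (T.pressure_ne_bot φ)) (.inl (T.pressure_ne_top hT φ)), add_comm]

theorem typeIEquilibriumStates_subset_typeIIEquilibriumStates :
    T.typeIEquilibriumStates φ ⊆ T.typeIIEquilibriumStates φ := by
  rintro p ⟨hp, hμ, heq⟩
  have ⟨_, hQ, _⟩ := hp
  refine ⟨hp, le_antisymm ?_ (T.abstractEntropy_add_doubleIntegral_le hQ φ)⟩
  rw [heq]
  gcongr
  exact T.kernelEntropy_le_abstractEntropy hQ hμ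

end EquilibriumStates

end Correspondence

theorem mainTheorem4 {X : Type*} [MetricSpace X] [CompactSpace X] [MeasurableSpace X]
    [BorelSpace X] (T : Correspondence X) (hT : T.topEntropy < ⊤) (φ : C(T.orbits 2, ℝ)) :
    T.typeIEquilibriumStates φ ⊆ T.tangentFunctionals φ ∧
      T.typeIIEquilibriumStates φ = T.tangentFunctionals φ := by
  have hII : T.typeIIEquilibriumStates φ = T.tangentFunctionals φ := by
    ext p
    exact Correspondence.mem_typeIIEquilibriumStates_iff.trans
      (Correspondence.mem_tangentFunctionals_iff hT).symm
  exact ⟨Correspondence.typeIEquilibriumStates_subset_typeIIEquilibriumStates.trans hII.subset, hII⟩
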